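/- \textbf{The lower bound graph.} For $k\ge 0$, $p\ge 1$ and $x,y\in\{0,1\}^k$, let $G(x,y)$ be the following graph. It consists of $k$ paths $v^i_0,v^i_1,\dots,v^i_{\ell}$ ($1\le i\le k$) on $2^p=\ell+1$ nodes each, and of a full binary tree of height $p$ with leaves $u_0,\dots,u_\ell$ numbered from left to right. For $0<j<\ell$, the leaf $u_j$ is joined to $v^i_j$ for all $i$. The leaf $s=u_0$ is joined to $v^i_0$ if and only if $x_i=0$, and the leaf $t=u_\ell$ is joined to $v^i_\ell$ if and only if $y_i=0$. Let $n=k2^p+2^{p+1}-1$ be the number of nodes. \textbf{The problems.} Set disjointness: $\mathrm{disj}(x,y)=1$ if there is no $i$ with $x_i=y_i=1$, and $\mathrm{disj}(x,y)=0$ otherwise. In the two-party problem (SD) Alice holds $x$, Bob holds $y$, and they compute $\mathrm{disj}(x,y)$ by a protocol (a binary protocol tree), whose cost is the worst-case number of bits exchanged. In the distributed problem (DSD) the network is $G(x,y)$, the node $s$ holds $x$, and the node $t$ holds $y$. Every node initially knows its name, its neighbours in $G(x,y)$ and its input, if any. In each synchronous round a node may send one message of at most $B$ bits over each incident edge. An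 algorithm solves DSD within $T$ rounds if after $T$ rounds some fixed node outputs $\mathrm{disj}(x,y)$, for all $x,y\in\{0,1\}^k$ (in particular this holds if $s$ and $t$, or all nodes, do so). \textbf{Theorem (Simulation Theorem).} For all real constants $c_1>0$, $c_2$, $\beta$ there is a constant $C>0$ such that the following holds for all $k,B,T\ge 0$ and $p\ge1$ with $c_1\sqrt n\le k\le c_2\sqrt n$ and $B\le\beta\log n$. (1) If a deterministic distributed algorithm with messages of at most $B$ bits solves DSD on the graphs $G(x,y)$, $x,y\in\{0,1\}^k$, within $T$ rounds, then there is a deterministic two-party protocol that computes $\mathrm{disj}$ on $\{0,1\}^k\times\{0,1\}^k$ and exchanges at most $C\,T\log^2 n$ bits. (2) The same holds for randomized (public-coin) algorithms and public-coin protocols: if a randomized distributed algorithm with messages of at most $B$ bits has error probability at most $\varepsilon$ on every input $(x,y)$ within $T$ rounds, then there is a randomized two-party protocol with error probability at most $\varepsilon$ on every input $(x,y)$ that always exchanges at most $C\,T\log^2 n$ bits. -/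

import Mathlib

/-- Set disjointness on `k`-bit vectors: `true` iff there is no `i` with `x i = y i = 1`. -/
def disj {k : ℕ} (x y : Fin k → Bool) : Bool :=
  decide (∀ i, ¬ (x i = true ∧ y i = true))

/-! ### Two-party communication -/

/-- A deterministic two-party protocol tree. At a node `alice f P₀ P₁`, Alice sends the bit
`f x`, and the players continue with `P₀` if it is `0` and with `P₁` if it is `1`; likewise
for Bob. A leaf carries the common answer. -/
inductive Protocol (X Y : Type) : Type
  | leaf (b : Bool) : Protocol X Y
  | alice (f : X → Bool) (P₀ P₁ : Protocol X Y) : Protocol X Y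
  | bob (g : Y → Bool) (P₀ P₁ : Protocol X Y) : Protocol X Y

namespace Protocol

variable {X Y : Type}

/-- The answer of the protocol on the inputs `x` (of Alice) and `y` (of Bob). -/
def eval : Protocol X Y → X → Y → Bool
  | leaf b, _, _ => b
  | alice f P₀ P₁, x, y => if f x = true then P₁.eval x y else P₀.eval x y
  | bob g P₀ P₁, x, y => if g y = true then P₁.eval x y else P₀.eval x y

/-- The number of bits exchanged in the worst case (the depth of the tree). -/
def cost : Protocol X Y → ℕ
  | leaf _ => 0
  | alice _ P₀ P₁ => max P₀.cost P₁.cost + 1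
  | bob _ P₀ P₁ => max P₀.cost P₁.cost + 1

end Protocol

/-! ### Synchronous message passing with bounded messages -/

/-- A message of at most `B` bits. -/
abbrev Message (B : ℕ) : Type := {m : List Bool // m.length ≤ B}

/-- A deterministic synchronous distributed algorithm on the vertex set `V`, with local inputs
in `I`, in which a node sends at most one message of at most `B` bits over each incident edge in
each round (`none` means that nothing is sent). Initially a node knows its name, its
neighbourhood and its local input. The program may depend on the node. -/
structure CongestAlgorithm (V I : Type) (B : ℕ) where
  State : Type
  init : V → Set V → I → State
  /-- `send u q v` is the message that `u`, in state `q`, sends to its neighbour `v`. -/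
  send : V → State → V → Option (Message B)
  /-- `receive v q m` is the new state of `v` when, in state `q`, it receives `m u` from each
  neighbour `u`. -/
  receive : V → State → (V → Option (Message B)) → State
  output : V → State → Bool

namespace CongestAlgorithm

variable {V I : Type} {B : ℕ}

open Classical in
/-- The states of all nodes after a number of rounds on the graph `G` with local inputs `inp`.
Messages travel along the edges of `G` only. -/
noncomputable def run (A : CongestAlgorithm V I B) (G : SimpleGraph V) (inp : V → I) :
    ℕ → V → A.State
  | 0, v => A.init v (G.neighborSet v) (inp v)
  | r + 1, v => A.receive v (A.run G inp r v)
      (fun u => if G.Adj u v then A.send u (A.run G inp r u) v else none)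

/-- The output of the node `v` after `T` rounds. -/
noncomputable def outputAfter (A : CongestAlgorithm V I B) (G : SimpleGraph V) (inp : V → I)
    (T : ℕ) (v : V) : Bool :=
  A.output v (A.run G inp T v)

end CongestAlgorithm

/-! ### The lower bound graph `G(x, y)` -/

/-- The vertices: the tree nodes `u_j^d` (depth `d ≤ p`, position `j < 2 ^ d`) and the path
nodes `v_j^i` (path `i < k`, position `j < 2 ^ p`). -/
abbrev LBVertex (k p : ℕ) : Type := (Σ d : Fin (p + 1), Fin (2 ^ (d : ℕ))) ⊕ (Fin k × Fin (2 ^ p))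

/-- The leaf number `j` of the tree. -/
def lbLeaf (k p : ℕ) (j : Fin (2 ^ p)) : LBVertex k p := Sum.inl ⟨Fin.last p, j⟩

/-- The node `s`: the leftmost leaf, which holds Alice's input. -/
def lbS (k p : ℕ) : LBVertex k p := lbLeaf k p ⟨0, by positivity⟩

/-- The node `t`: the rightmost leaf, which holds Bob's input. -/
def lbT (k p : ℕ) : LBVertex k p :=
  lbLeaf k p ⟨2 ^ p - 1, Nat.sub_lt (by positivity) one_pos⟩

/-- The edges, each in one direction: tree edges (parent to child), path edges (left to right),
and spoke edges from leaf `j` to the `j`-th node of every path, where the spoke from `s` to path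
`i` is present iff `x i = 0` and the spoke from `t` to path `i` is present iff `y i = 0`. -/
inductive LBEdge {k p : ℕ} (x y : Fin k → Bool) : LBVertex k p → LBVertex k p → Prop
  | tree (d e : Fin (p + 1)) (i : Fin (2 ^ (d : ℕ))) (j : Fin (2 ^ (e : ℕ)))
      (hd : (e : ℕ) = d + 1) (hj : (j : ℕ) / 2 = i) :
      LBEdge x y (Sum.inl ⟨d, i⟩) (Sum.inl ⟨e, j⟩)
  | path (i : Fin k) (j j' : Fin (2 ^ p)) (hj : (j' : ℕ) = j + 1) :
      LBEdge x y (Sum.inr (i, j)) (Sum.inr (i, j'))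
  | spoke (i : Fin k) (j : Fin (2 ^ p))
      (hs : (j : ℕ) = 0 → x i = false) (ht : (j : ℕ) = 2 ^ p - 1 → y i = false) :
      LBEdge x y (lbLeaf k p j) (Sum.inr (i, j))

/-- The graph `G(x, y)` with `k` paths on `2 ^ p` nodes each and a full binary tree of
height `p`. -/
def lbGraph {k : ℕ} (p : ℕ) (x y : Fin k → Bool) : SimpleGraph (LBVertex k p) :=
  SimpleGraph.fromRel (LBEdge x y)

/-- The local inputs: `s` holds `x`, `t` holds `y`, and the other nodes have none. -/
def dsdInput {k : ℕ} (p : ℕ) (x y : Fin k → Bool) (v : LBVertex k p) : Option (Fin k → Bool) :=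
  if v = lbS k p then some x else if v = lbT k p then some y else none

/-- Deterministic distributed algorithms for disjointness on the family `G(x, y)`, with
messages of at most `B` bits. -/
abbrev DSDAlgorithm (k p B : ℕ) : Type 1 :=
  CongestAlgorithm (LBVertex k p) (Option (Fin k → Bool)) B

/-- What the node `v` answers after `A` has run for `T` rounds on `G(x, y)`. -/
noncomputable def DSDAlgorithm.answer {k p B : ℕ} (A : DSDAlgorithm k p B) (T : ℕ)
    (v : LBVertex k p) (x y : Fin k → Bool) : Bool :=
  CongestAlgorithm.outputAfter A (lbGraph p x y) (dsdInput p x y) T v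

/-- A function `F` that depends on inputs `x, y` and on a random `ω` computes disjointness with
error probability at most `ε` on every input. -/
def ComputesDisjWithError {k : ℕ} {Ω : Type*} [MeasurableSpace Ω]
    (μ : MeasureTheory.Measure Ω) (ε : ENNReal)
    (F : Ω → (Fin k → Bool) → (Fin k → Bool) → Bool) : Prop :=
  ∀ x y, MeasurableSet {ω | F ω x y ≠ disj x y} ∧ μ {ω | F ω x y ≠ disj x y} ≤ ε

/-! ### Building protocols -/

/-! Alice simulates a left part of the graph that avoids the data of `t`, and Bob a right part that
avoids the data of `s`. Each round both fronts recede by one position. Path edges move by one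
position and spokes by none, so they carry nothing new into the smaller part; only tree edges can.
Those that do join an ancestor of one boundary leaf to a child (`exists_crossing_of_aliceRegion`,
`exists_crossing_of_bobRegion`), so there are at most `p` per player. If the two parts still cover
the graph, the other player knows the senders' states and announces these messages, at `2 * p * (B +
1)` bits per round (`DSDAlgorithm.exists_transmits`). As `p` and `B` are `O(log n)`, the total is
`O(T log² n)`.

The parts cover the graph while `2 * T + 2 ≤ 2 ^ p`. For larger `T`, the bounds `n ≤ 3 * k * 2 ^ p`
and `k ≤ c₂ * √n` give `k = O(T)`, so sending the whole input is cheap enough (`trivial_cost_le`).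
The case `T = 0` allows no bit at all and is treated separately. -/

/-- `Transmits τ c`: exchanging at most `c` bits, the players can make the value `τ x y` common
knowledge, and continue with a protocol that depends on it. -/
def Protocol.Transmits {X Y M : Type} (τ : X → Y → M) (c : ℕ) : Prop :=
  ∀ (Q : M → Protocol X Y) (d : ℕ), (∀ m, (Q m).cost ≤ d) →
    ∃ P : Protocol X Y, (∀ x y, P.eval x y = (Q (τ x y)).eval x y) ∧ P.cost ≤ c + d

namespace Protocol

variable {X Y M N : Type}

theorem Transmits.const (m : M) : Transmits (fun (_ : X) (_ : Y) => m) 0 :=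
  fun Q _ hQ => ⟨Q m, fun _ _ => rfl, by simpa using hQ m⟩

theorem Transmits.comp {τ : X → Y → M} {c : ℕ} (h : Transmits τ c) (g : M → N) :
    Transmits (fun x y => g (τ x y)) c :=
  fun Q d hQ => h (fun m => Q (g m)) d fun m => hQ (g m)

/-- Alice announces one bit. -/
theorem Transmits.alice_bit {τ : X → Y → M} {c : ℕ} (h : Transmits τ c) (f : M → X → Bool) :
    Transmits (fun x y => (τ x y, f (τ x y) x)) (c + 1) := by
  intro Q d hQ
  obtain ⟨P, hP, hc⟩ := h (fun m => .alice (f m) (Q (m, false)) (Q (m, true))) (d + 1)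
    fun m => by simp [cost, hQ]
  refine ⟨P, fun x y => ?_, by omega⟩
  rw [hP, eval]
  cases hf : f (τ x y) x <;> simp [hf]

/-- Bob announces one bit. -/
theorem Transmits.bob_bit {τ : X → Y → M} {c : ℕ} (h : Transmits τ c) (f : M → Y → Bool) :
    Transmits (fun x y => (τ x y, f (τ x y) y)) (c + 1) := by
  intro Q d hQ
  obtain ⟨P, hP, hc⟩ := h (fun m => .bob (f m) (Q (m, false)) (Q (m, true))) (d + 1)
    fun m => by simp [cost, hQ]
  refine ⟨P, fun x y => ?_, by omega⟩
  rw [hP, eval]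
  cases hf : f (τ x y) y <;> simp [hf]

theorem Transmits.alice_bits {τ : X → Y → M} {c : ℕ} (h : Transmits τ c) (b : ℕ)
    (f : M → X → Fin b → Bool) : Transmits (fun x y => (τ x y, f (τ x y) x)) (c + b) := by
  induction b with
  | zero =>
    rw [add_zero]
    convert h.comp (fun m => (m, (Fin.elim0 : Fin 0 → Bool))) using 4
  | succ b ih =>
    -- The tail goes first and bit `0` last; `Fin.cons` restores the order.
    have := ((ih fun m x i => f m x i.succ).alice_bit fun m x => f m.1 x 0).comp
      fun m => (m.1.1, (Fin.cons m.2 m.1.2 : Fin (b + 1) → Bool))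
    rw [← add_assoc]
    convert this using 4 with x y
    exact (Fin.cons_self_tail (f (τ x y) x)).symm

theorem Transmits.bob_bits {τ : X → Y → M} {c : ℕ} (h : Transmits τ c) (b : ℕ)
    (f : M → Y → Fin b → Bool) : Transmits (fun x y => (τ x y, f (τ x y) y)) (c + b) := by
  induction b with
  | zero =>
    rw [add_zero]
    convert h.comp (fun m => (m, (Fin.elim0 : Fin 0 → Bool))) using 4
  | succ b ih =>
    have := ((ih fun m y i => f m y i.succ).bob_bit fun m y => f m.1 y 0).comp
      fun m => (m.1.1, (Fin.cons m.2 m.1.2 : Fin (b + 1) → Bool))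
    rw [← add_assoc]
    convert this using 4 with x y
    exact (Fin.cons_self_tail (f (τ x y) y)).symm

theorem exists_leftInverse_bits [Fintype N] [Nonempty N] {b : ℕ} (hb : Fintype.card N ≤ 2 ^ b) :
    ∃ (e : N → Fin b → Bool) (g : (Fin b → Bool) → N), ∀ n, g (e n) = n := by
  obtain ⟨e⟩ := Function.Embedding.nonempty_of_card_le
    (α := N) (β := Fin b → Bool) (by simpa using hb)
  exact ⟨e, Function.invFun e, Function.leftInverse_invFun e.injective⟩

/-- Since `m` is constant on the fibres of `(τ, π)`, any representative of a fibre gives its value.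
This turns "determined by one's own input and the transcript" into an actual function for a protocol
node. -/
theorem exists_factor {Z : Type} [Nonempty N] {τ : X → Y → M} {π : X → Y → Z} {m : X → Y → N}
    (h : ∀ x y x' y', π x y = π x' y' → τ x y = τ x' y' → m x y = m x' y') :
    ∃ f : M → Z → N, ∀ x y, f (τ x y) (π x y) = m x y := by
  classical
  refine ⟨fun t z => if H : ∃ q : X × Y, τ q.1 q.2 = t ∧ π q.1 q.2 = z then
    m H.choose.1 H.choose.2 else Classical.arbitrary N, fun x y => ?_⟩
  have H : ∃ q : X × Y, τ q.1 q.2 = τ x y ∧ π q.1 q.2 = π x y := ⟨(x, y), rfl, rfl⟩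
  simp only [dif_pos H]
  exact h _ _ _ _ H.choose_spec.2 H.choose_spec.1

/-- Alice announces a value that she can compute from her input and the common knowledge. -/
theorem Transmits.alice [Fintype N] [Nonempty N] {τ : X → Y → M} {c b : ℕ} (h : Transmits τ c)
    (hb : Fintype.card N ≤ 2 ^ b) (m : X → Y → N)
    (hm : ∀ x y y', τ x y = τ x y' → m x y = m x y') :
    Transmits (fun x y => (τ x y, m x y)) (c + b) := by
  obtain ⟨e, g, hg⟩ := exists_leftInverse_bits hb
  obtain ⟨f, hf⟩ := exists_factor (τ := τ) (π := fun x _ => x) (m := m)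
    (by rintro x y _ y' rfl; exact hm x y y')
  simpa [hg, hf] using (h.alice_bits b fun t x => e (f t x)).comp fun t => (t.1, g t.2)

/-- Bob announces a value that he can compute from his input and the common knowledge. -/
theorem Transmits.bob [Fintype N] [Nonempty N] {τ : X → Y → M} {c b : ℕ} (h : Transmits τ c)
    (hb : Fintype.card N ≤ 2 ^ b) (m : X → Y → N)
    (hm : ∀ x x' y, τ x y = τ x' y → m x y = m x' y) :
    Transmits (fun x y => (τ x y, m x y)) (c + b) := by
  obtain ⟨e, g, hg⟩ := exists_leftInverse_bits hb
  obtain ⟨f, hf⟩ := exists_factor (τ := τ) (π := fun _ y => y) (m := m)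
    (by rintro x y x' _ rfl; exact hm x x' y)
  simpa [hg, hf] using (h.bob_bits b fun t y => e (f t y)).comp fun t => (t.1, g t.2)

theorem Transmits.exists_protocol {τ : X → Y → M} {c : ℕ} (h : Transmits τ c) (g : M → Bool) :
    ∃ P : Protocol X Y, (∀ x y, P.eval x y = g (τ x y)) ∧ P.cost ≤ c := by
  obtain ⟨P, hP, hc⟩ := h (fun m => .leaf (g m)) 0 fun m => le_rfl
  exact ⟨P, fun x y => by rw [hP, eval], hc⟩

end Protocol

/-- Every function of two `k`-bit vectors has a protocol that exchanges `k + 1` bits. -/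
theorem exists_protocol_of_function {k : ℕ} (F : (Fin k → Bool) → (Fin k → Bool) → Bool) :
    ∃ P : Protocol (Fin k → Bool) (Fin k → Bool),
      (∀ x y, P.eval x y = F x y) ∧ P.cost ≤ k + 1 := by
  have h := ((Protocol.Transmits.const ()).alice_bits (Y := Fin k → Bool) k
    fun _ (x : Fin k → Bool) => x).bob_bit fun m y => F m.2 y
  obtain ⟨P, hP, hc⟩ := h.exists_protocol Prod.snd
  exact ⟨P, hP, by omega⟩

/-! ### Messages -/

/-- The binary digits of the number that encodes a message or silence. -/
def messageDigits {B : ℕ} (m : Option (Message B)) : List ℕ :=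
  m.elim [] fun m => m.1.map Bool.toNat ++ [1]

theorem messageDigits_injective (B : ℕ) :
    Function.Injective (messageDigits : Option (Message B) → List ℕ) := by
  have hinj : Function.Injective Bool.toNat := by decide
  rintro (_ | m) (_ | m') h
  · rfl
  · simp [messageDigits] at h
  · simp [messageDigits] at h
  · simp only [messageDigits, Option.elim_some, List.append_cancel_right_eq] at h
    exact congrArg some (Subtype.ext (List.map_injective_iff.2 hinj h))

/-- The final `1` keeps the leading digit nonzero, so no zeros of a message are lost; it also
separates the empty message from silence. -/
theorem digits_ofDigits_messageDigits {B : ℕ} (m : Option (Message B)) :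
    Nat.digits 2 (Nat.ofDigits 2 (messageDigits m)) = messageDigits m := by
  refine Nat.digits_ofDigits 2 one_lt_two _ ?_ ?_
  · rcases m with _ | m
    · simp [messageDigits]
    · simp only [messageDigits, Option.elim_some, List.mem_append, List.mem_map,
        List.mem_singleton]
      rintro l (⟨b, -, rfl⟩ | rfl)
      · exact b.toNat_lt
      · exact one_lt_two
  · rcases m with _ | m <;> simp [messageDigits]

theorem ofDigits_messageDigits_lt {B : ℕ} (m : Option (Message B)) :
    Nat.ofDigits 2 (messageDigits m) < 2 ^ (B + 1) := by
  rw [← Nat.digits_length_le_iff one_lt_two, digits_ofDigits_messageDigits]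
  rcases m with _ | m
  · simp [messageDigits]
  · simpa [messageDigits] using m.2

instance messageFinite (B : ℕ) : Finite (Message B) :=
  (List.finite_length_le Bool B).to_subtype

noncomputable instance messageFintype (B : ℕ) : Fintype (Message B) := Fintype.ofFinite _

theorem card_option_message_le (B : ℕ) : Fintype.card (Option (Message B)) ≤ 2 ^ (B + 1) := by
  have hinj : Function.Injective fun m : Option (Message B) =>
      (⟨Nat.ofDigits 2 (messageDigits m), ofDigits_messageDigits_lt m⟩ : Fin (2 ^ (B + 1))) := by
    intro m m' h
    apply messageDigits_injective
    rw [← digits_ofDigits_messageDigits m, ← digits_ofDigits_messageDigits m']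
    exact congrArg (Nat.digits 2) (Fin.ext_iff.1 h)
  simpa using Fintype.card_le_of_injective _ hinj

theorem card_message_bundle_le (p B : ℕ) :
    Fintype.card (Fin p → Option (Message B)) ≤ 2 ^ (p * (B + 1)) := by
  rw [Fintype.card_fun, Fintype.card_fin, mul_comm, pow_mul]
  exact Nat.pow_le_pow_left (card_option_message_le B) p

/-! ### Locality of the execution -/

/-- One round is local: the new state depends only on the old one and on what arrives along incident
edges. -/
theorem CongestAlgorithm.run_succ_congr {V I : Type} {B : ℕ} (A : CongestAlgorithm V I B)
    {G G' : SimpleGraph V} {inp inp' : V → I} {r : ℕ} {w : V}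
    (hw : A.run G inp r w = A.run G' inp' r w) (hadj : ∀ u, G.Adj u w ↔ G'.Adj u w)
    (hmsg : ∀ u, G.Adj u w →
      A.send u (A.run G inp r u) w = A.send u (A.run G' inp' r u) w) :
    A.run G inp (r + 1) w = A.run G' inp' (r + 1) w := by
  simp only [CongestAlgorithm.run, hw]
  congr 1
  funext u
  by_cases h : G.Adj u w
  · rw [if_pos h, if_pos ((hadj u).1 h), hmsg u h]
  · rw [if_neg h, if_neg (mt (hadj u).2 h)]

/-! ### The regions that the players simulate -/

/-- The nodes whose state after `r` rounds Alice computes: those of which some leaf below, or the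
path position, is at most `2 ^ p - 2 - r`. -/
def aliceRegion (k p r : ℕ) : Set (LBVertex k p) :=
  {v | Sum.elim (fun a => (a.2 : ℕ) * 2 ^ (p - (a.1 : ℕ))) (fun a => (a.2 : ℕ)) v + r + 2 ≤ 2 ^ p}

/-- The nodes whose state after `r` rounds Bob computes: those of which some leaf below, or the
path position, is at least `r + 1`. -/
def bobRegion (k p r : ℕ) : Set (LBVertex k p) :=
  {v | r + 2 ≤ Sum.elim (fun a => ((a.2 : ℕ) + 1) * 2 ^ (p - (a.1 : ℕ))) (fun a => (a.2 : ℕ) + 1) v}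

section LowerBoundGraph

variable {k p r : ℕ}

theorem aliceRegion_anti {r' : ℕ} (h : r ≤ r') : aliceRegion k p r' ⊆ aliceRegion k p r := by
  intro v hv
  simp only [aliceRegion, Set.mem_ofPred_eq] at *
  omega

theorem bobRegion_anti {r' : ℕ} (h : r ≤ r') : bobRegion k p r' ⊆ bobRegion k p r := by
  intro v hv
  simp only [bobRegion, Set.mem_ofPred_eq] at *
  omega

/-- A position beyond `2 ^ p - 2 - r` is at least `r + 1` under `hr`; for a tree node, apply this to
its leftmost leaf. -/
theorem mem_aliceRegion_or_bobRegion (hr : 2 * r + 2 ≤ 2 ^ p) (v : LBVertex k p) :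
    v ∈ aliceRegion k p r ∨ v ∈ bobRegion k p r := by
  simp only [aliceRegion, bobRegion, Set.mem_ofPred_eq]
  rcases v with ⟨d, i⟩ | ⟨i, j⟩
  · have : 0 < 2 ^ (p - (d : ℕ)) := by positivity
    simp only [Sum.elim_inl, add_mul, one_mul]
    omega
  · simp only [Sum.elim_inr]
    omega

theorem lbT_notMem_aliceRegion : lbT k p ∉ aliceRegion k p r := by
  simp [aliceRegion, lbT, lbLeaf]
  omega

theorem lbS_notMem_bobRegion : lbS k p ∉ bobRegion k p r := by
  simp [bobRegion, lbS, lbLeaf]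

/-- Only the spokes at `t` depend on Bob's input, and both of their ends have position `2 ^ p - 1`,
outside Alice's region for every `r`. -/
theorem LBEdge.of_aliceRegion {x y y' : Fin k → Bool} {u w : LBVertex k p}
    (h : LBEdge x y u w) (hw : u ∈ aliceRegion k p r ∨ w ∈ aliceRegion k p r) :
    LBEdge x y' u w := by
  cases h with
  | tree d e i j hd hj => exact .tree d e i j hd hj
  | path i j j' hj => exact .path i j j' hj
  | spoke i j hs ht =>
    refine .spoke i j hs fun hj => ?_
    simp [aliceRegion, lbLeaf] at hw
    omega

theorem LBEdge.of_bobRegion {x x' y : Fin k → Bool} {u w : LBVertex k p}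
    (h : LBEdge x y u w) (hw : u ∈ bobRegion k p r ∨ w ∈ bobRegion k p r) :
    LBEdge x' y u w := by
  cases h with
  | tree d e i j hd hj => exact .tree d e i j hd hj
  | path i j j' hj => exact .path i j j' hj
  | spoke i j hs ht =>
    refine .spoke i j (fun hj => ?_) ht
    simp [bobRegion, lbLeaf] at hw
    omega

theorem lbGraph_adj_iff_of_aliceRegion {x y y' : Fin k → Bool} {u w : LBVertex k p}
    (hw : w ∈ aliceRegion k p r) : (lbGraph p x y).Adj u w ↔ (lbGraph p x y').Adj u w := by
  simp only [lbGraph, SimpleGraph.fromRel_adj]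
  exact and_congr_right fun _ => or_congr
    ⟨fun h => h.of_aliceRegion (.inr hw), fun h => h.of_aliceRegion (.inr hw)⟩
    ⟨fun h => h.of_aliceRegion (.inl hw), fun h => h.of_aliceRegion (.inl hw)⟩

theorem lbGraph_adj_iff_of_bobRegion {x x' y : Fin k → Bool} {u w : LBVertex k p}
    (hw : w ∈ bobRegion k p r) : (lbGraph p x y).Adj u w ↔ (lbGraph p x' y).Adj u w := by
  simp only [lbGraph, SimpleGraph.fromRel_adj]
  exact and_congr_right fun _ => or_congr
    ⟨fun h => h.of_bobRegion (.inr hw), fun h => h.of_bobRegion (.inr hw)⟩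
    ⟨fun h => h.of_bobRegion (.inl hw), fun h => h.of_bobRegion (.inl hw)⟩

/-- The ancestor of the leaf `a` at depth `d`. -/
def leafAncestor (k : ℕ) {p : ℕ} (a : Fin (2 ^ p)) (d : Fin p) : LBVertex k p :=
  Sum.inl ⟨d.castSucc, ⟨a / 2 ^ (p - (d : ℕ)), by
    rw [Nat.div_lt_iff_lt_mul (by positivity), Fin.val_castSucc, ← pow_add,
      Nat.add_sub_cancel' d.2.le]
    exact a.2⟩⟩

/-- A child of the ancestor of the leaf `a` at depth `d`: the left one for `c = 0`, the right one
for `c = 1`. -/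
def leafAncestorChild (k : ℕ) {p : ℕ} (a : Fin (2 ^ p)) (c : Fin 2) (d : Fin p) : LBVertex k p :=
  Sum.inl ⟨d.succ, ⟨2 * (a / 2 ^ (p - (d : ℕ))) + c, by
    have : (a : ℕ) / 2 ^ (p - (d : ℕ)) < 2 ^ (d : ℕ) := by
      rw [Nat.div_lt_iff_lt_mul (by positivity), ← pow_add, Nat.add_sub_cancel' d.2.le]
      exact a.2
    rw [Fin.val_succ, pow_succ]
    omega⟩⟩

/-- The only edges from outside of Alice's region after `r` rounds into her region after `r + 1`
rounds join an ancestor of the leaf `2 ^ p - 2 - r` to its right child. -/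
theorem exists_crossing_of_aliceRegion {x y : Fin k → Bool} {u w : LBVertex k p}
    (hw : w ∈ aliceRegion k p (r + 1)) (hu : u ∉ aliceRegion k p r)
    (h : (lbGraph p x y).Adj u w) (a : Fin (2 ^ p)) (ha : (a : ℕ) + r + 2 = 2 ^ p) :
    ∃ d, leafAncestorChild k a 1 d = u ∧ leafAncestor k a d = w := by
  simp only [aliceRegion, Set.mem_ofPred_eq] at hu hw
  rw [lbGraph, SimpleGraph.fromRel_adj] at h
  rcases h.2 with h | h
  · cases h with
    | tree d e i j hd hj =>
      -- A parent's leftmost leaf is at most its child's, so news from a parent never crosses the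
      -- front.
      exfalso
      have he : p - (d : ℕ) = p - e + 1 := by omega
      simp only [Sum.elim_inl, he, pow_succ] at hu hw
      have : (i : ℕ) * (2 ^ (p - (e : ℕ)) * 2) ≤ j * 2 ^ (p - (e : ℕ)) := by
        rw [mul_comm _ 2, ← mul_assoc]
        exact Nat.mul_le_mul_right _ (by omega)
      omega
    | path i j j' hj => simp at hu hw; omega
    | spoke i j hs ht => simp [lbLeaf] at hu hw; omega
  · cases h with
    | tree d e i j hd hj =>
      have he : p - (d : ℕ) = p - e + 1 := by omega
      simp only [Sum.elim_inl, he, pow_succ] at hu hw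
      have hP : 0 < 2 ^ (p - (e : ℕ)) := by positivity
      -- A left child shares its leftmost leaf with its parent, so it would not be outside.
      have hji : (j : ℕ) = 2 * i + 1 := by
        by_contra hne
        have hji : (j : ℕ) = 2 * i := by omega
        rw [hji] at hu
        have : 2 * (i : ℕ) * 2 ^ (p - (e : ℕ)) = i * (2 ^ (p - (e : ℕ)) * 2) := by ring
        omega
      rw [hji] at hu
      -- The leaf `a` lies between the leftmost leaf of `w` and that of its right child `u`, hence
      -- below `w`.
      have hq : (a : ℕ) / 2 ^ (p - (d : ℕ)) = i := by
        rw [he, pow_succ]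
        apply Nat.div_eq_of_lt_le
        · omega
        · have h1 : ((i : ℕ) + 1) * (2 ^ (p - (e : ℕ)) * 2) =
            (2 * i + 1) * 2 ^ (p - (e : ℕ)) + 2 ^ (p - (e : ℕ)) := by ring
          omega
      have hdp : (d : ℕ) < p := by omega
      obtain ⟨d, rfl⟩ : ∃ d' : Fin p, d = d'.castSucc := ⟨⟨d, hdp⟩, rfl⟩
      obtain rfl : e = d.succ := Fin.ext hd
      refine ⟨d, ?_, ?_⟩
      · simp only [leafAncestorChild]
        congr 2
        exact Fin.ext (by simpa [hji] using hq)
      · simp only [leafAncestor]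
        congr 2
        exact Fin.ext hq
    | path i j j' hj => simp at hu hw; omega
    | spoke i j hs ht => simp [lbLeaf] at hu hw; omega

/-- The only edges from outside of Bob's region after `r` rounds into his region after `r + 1`
rounds join an ancestor of the leaf `r + 1` to its left child. -/
theorem exists_crossing_of_bobRegion {x y : Fin k → Bool} {u w : LBVertex k p}
    (hw : w ∈ bobRegion k p (r + 1)) (hu : u ∉ bobRegion k p r)
    (h : (lbGraph p x y).Adj u w) (a : Fin (2 ^ p)) (ha : (a : ℕ) = r + 1) :
    ∃ d, leafAncestorChild k a 0 d = u ∧ leafAncestor k a d = w := by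
  simp only [bobRegion, Set.mem_ofPred_eq] at hu hw
  rw [lbGraph, SimpleGraph.fromRel_adj] at h
  rcases h.2 with h | h
  · cases h with
    | tree d e i j hd hj =>
      exfalso
      have he : p - (d : ℕ) = p - e + 1 := by omega
      simp only [Sum.elim_inl, he, pow_succ] at hu hw
      have : ((j : ℕ) + 1) * 2 ^ (p - (e : ℕ)) ≤ (i + 1) * (2 ^ (p - (e : ℕ)) * 2) := by
        rw [mul_comm _ 2, ← mul_assoc]
        exact Nat.mul_le_mul_right _ (by omega)
      omega
    | path i j j' hj => simp at hu hw; omega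
    | spoke i j hs ht => simp [lbLeaf] at hu hw; omega
  · cases h with
    | tree d e i j hd hj =>
      have he : p - (d : ℕ) = p - e + 1 := by omega
      simp only [Sum.elim_inl, he, pow_succ] at hu hw
      have hP : 0 < 2 ^ (p - (e : ℕ)) := by positivity
      have hji : (j : ℕ) = 2 * i := by
        by_contra hne
        have hji : (j : ℕ) = 2 * i + 1 := by omega
        rw [hji] at hu
        have : (2 * (i : ℕ) + 1 + 1) * 2 ^ (p - (e : ℕ)) =
          (i + 1) * (2 ^ (p - (e : ℕ)) * 2) := by ring
        omega
      rw [hji] at hu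
      -- Mirror image: `a` lies to the right of all leaves below the left child `u`, but still below
      -- `w`.
      have hq : (a : ℕ) / 2 ^ (p - (d : ℕ)) = i := by
        rw [he, pow_succ]
        apply Nat.div_eq_of_lt_le
        · have h1 : (2 * (i : ℕ) + 1) * 2 ^ (p - (e : ℕ)) =
            i * (2 ^ (p - (e : ℕ)) * 2) + 2 ^ (p - (e : ℕ)) := by ring
          omega
        · omega
      have hdp : (d : ℕ) < p := by omega
      obtain ⟨d, rfl⟩ : ∃ d' : Fin p, d = d'.castSucc := ⟨⟨d, hdp⟩, rfl⟩
      obtain rfl : e = d.succ := Fin.ext hd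
      refine ⟨d, ?_, ?_⟩
      · simp only [leafAncestorChild]
        congr 2
        exact Fin.ext (by simpa [hji] using hq)
      · simp only [leafAncestor]
        congr 2
        exact Fin.ext hq
    | path i j j' hj => simp at hu hw; omega
    | spoke i j hs ht => simp [lbLeaf] at hu hw; omega

/-! ### The simulation -/

theorem dsdInput_eq_of_aliceRegion {x y y' : Fin k → Bool} {v : LBVertex k p}
    (hv : v ∈ aliceRegion k p r) : dsdInput p x y v = dsdInput p x y' v := by
  have : v ≠ lbT k p := fun h => lbT_notMem_aliceRegion (h ▸ hv)
  simp [dsdInput, this]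

theorem dsdInput_eq_of_bobRegion {x x' y : Fin k → Bool} {v : LBVertex k p}
    (hv : v ∈ bobRegion k p r) : dsdInput p x y v = dsdInput p x' y v := by
  have : v ≠ lbS k p := fun h => lbS_notMem_bobRegion (h ▸ hv)
  simp [dsdInput, this]

open Protocol

section Simulation

variable {B : ℕ} (A : DSDAlgorithm k p B)

/-- The state of `v` after `r` rounds on `G(x, y)`. -/
noncomputable def DSDAlgorithm.stateAfter (r : ℕ) (v : LBVertex k p) (x y : Fin k → Bool) :
    A.State :=
  CongestAlgorithm.run A (lbGraph p x y) (dsdInput p x y) r v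

theorem DSDAlgorithm.stateAfter_zero_of_aliceRegion {v : LBVertex k p}
    (hv : v ∈ aliceRegion k p r) (x y y' : Fin k → Bool) :
    A.stateAfter 0 v x y = A.stateAfter 0 v x y' := by
  have : (lbGraph p x y).neighborSet v = (lbGraph p x y').neighborSet v := by
    ext u
    simp only [SimpleGraph.mem_neighborSet, SimpleGraph.adj_comm _ v,
      lbGraph_adj_iff_of_aliceRegion (y := y) (y' := y') hv]
  simp only [stateAfter, CongestAlgorithm.run, this,
    dsdInput_eq_of_aliceRegion (y := y) (y' := y') hv]

theorem DSDAlgorithm.stateAfter_zero_of_bobRegion {v : LBVertex k p}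
    (hv : v ∈ bobRegion k p r) (x x' y : Fin k → Bool) :
    A.stateAfter 0 v x y = A.stateAfter 0 v x' y := by
  have : (lbGraph p x y).neighborSet v = (lbGraph p x' y).neighborSet v := by
    ext u
    simp only [SimpleGraph.mem_neighborSet, SimpleGraph.adj_comm _ v,
      lbGraph_adj_iff_of_bobRegion (x := x) (x' := x') hv]
  simp only [stateAfter, CongestAlgorithm.run, this,
    dsdInput_eq_of_bobRegion (x := x) (x' := x') hv]

open Classical in
/-- The messages sent in round `r + 1` by those children of the ancestors of the leaf `a`
that lie in `S` to their parents. -/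
noncomputable def DSDAlgorithm.messagesToAncestors (S : Set (LBVertex k p)) (a : Fin (2 ^ p))
    (c : Fin 2) (r : ℕ) (x y : Fin k → Bool) (d : Fin p) : Option (Message B) :=
  if leafAncestorChild k a c d ∈ S then
    A.send (leafAncestorChild k a c d) (A.stateAfter r (leafAncestorChild k a c d) x y)
      (leafAncestor k a d)
  else none

/-- The simulation: with `2 * p * (B + 1)` bits per round, the players can keep track of the states
in their regions, as long as these cover the graph. -/
theorem DSDAlgorithm.exists_transmits (r : ℕ) (hr : 2 * r + 2 ≤ 2 ^ p) :
    ∃ (M : Type) (τ : (Fin k → Bool) → (Fin k → Bool) → M),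
      Transmits τ (r * (2 * (p * (B + 1)))) ∧
      (∀ v ∈ aliceRegion k p r, ∀ x y y', τ x y = τ x y' →
        A.stateAfter r v x y = A.stateAfter r v x y') ∧
      (∀ v ∈ bobRegion k p r, ∀ x x' y, τ x y = τ x' y →
        A.stateAfter r v x y = A.stateAfter r v x' y) := by
  induction r with
  | zero =>
    refine ⟨Unit, fun _ _ => (), ?_, fun v hv x y y' _ => A.stateAfter_zero_of_aliceRegion hv x y y',
      fun v hv x x' y _ => A.stateAfter_zero_of_bobRegion hv x x' y⟩
    simpa using Transmits.const ()
  | succ r ih =>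
    obtain ⟨M, τ, hτ, hA, hB⟩ := ih (by omega)
    -- `a` is the last leaf in Alice's region after `r` rounds, and `b` the first in Bob's.
    let a : Fin (2 ^ p) := ⟨2 ^ p - 2 - r, by omega⟩
    let b : Fin (2 ^ p) := ⟨r + 1, by omega⟩
    have ha : (a : ℕ) + r + 2 = 2 ^ p := by simp only [a]; omega
    let toBob := A.messagesToAncestors (aliceRegion k p r) b 0 r
    let toAlice := A.messagesToAncestors (bobRegion k p r) a 1 r
    have htoBob : ∀ x y y', τ x y = τ x y' → toBob x y = toBob x y' := by
      intro x y y' h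
      funext d
      simp only [toBob, messagesToAncestors]
      split_ifs with hd
      · rw [hA _ hd x y y' h]
      · rfl
    have htoAlice : ∀ x x' y, τ x y = τ x' y → toAlice x y = toAlice x' y := by
      intro x x' y h
      funext d
      simp only [toAlice, messagesToAncestors]
      split_ifs with hd
      · rw [hB _ hd x x' y h]
      · rfl
    refine ⟨(M × (Fin p → Option (Message B))) × (Fin p → Option (Message B)),
      fun x y => ((τ x y, toBob x y), toAlice x y), ?_, ?_, ?_⟩
    · have := (hτ.alice (card_message_bundle_le p B) toBob htoBob).bob
        (card_message_bundle_le p B) toAlice fun x x' y h => htoAlice x x' y (Prod.ext_iff.1 h).1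
      convert this using 1
      ring
    · intro w hw x y y' h
      simp only [Prod.mk.injEq] at h
      refine CongestAlgorithm.run_succ_congr A
        (hA w (aliceRegion_anti r.le_succ hw) x y y' h.1.1)
        (fun u => lbGraph_adj_iff_of_aliceRegion hw) fun u hu => ?_
      by_cases hur : u ∈ aliceRegion k p r
      · exact congrArg (A.send u · w) (hA u hur x y y' h.1.1)
      · obtain ⟨d, rfl, rfl⟩ := exists_crossing_of_aliceRegion hw hur hu a ha
        -- The sender is outside Alice's region, so by covering it is in Bob's, and the announced
        -- value is its real message rather than the default `none`.
        have hub := (mem_aliceRegion_or_bobRegion (by omega) _).resolve_left hur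
        have hd := congrFun h.2 d
        simp only [toAlice, messagesToAncestors, if_pos hub] at hd
        exact hd
    · intro w hw x x' y h
      simp only [Prod.mk.injEq] at h
      refine CongestAlgorithm.run_succ_congr A
        (hB w (bobRegion_anti r.le_succ hw) x x' y h.1.1)
        (fun u => lbGraph_adj_iff_of_bobRegion hw) fun u hu => ?_
      by_cases hur : u ∈ bobRegion k p r
      · exact congrArg (A.send u · w) (hB u hur x x' y h.1.1)
      · obtain ⟨d, rfl, rfl⟩ := exists_crossing_of_bobRegion hw hur hu b rfl
        have hua := (mem_aliceRegion_or_bobRegion (by omega) _).resolve_right hur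
        have hd := congrFun h.1.2 d
        simp only [toBob, messagesToAncestors, if_pos hua] at hd
        exact hd

/-- As long as the regions cover the graph, the answer of every node can be computed by a
two-party protocol. -/
theorem DSDAlgorithm.exists_protocol (T : ℕ) (hT : 2 * T + 2 ≤ 2 ^ p) (v : LBVertex k p) :
    ∃ P : Protocol (Fin k → Bool) (Fin k → Bool),
      (∀ x y, P.eval x y = A.answer T v x y) ∧ P.cost ≤ T * (2 * (p * (B + 1))) + 1 := by
  obtain ⟨M, τ, hτ, hA, hB⟩ := A.exists_transmits T hT
  have hcard : Fintype.card Bool ≤ 2 ^ 1 := by simp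
  rcases mem_aliceRegion_or_bobRegion hT v with hv | hv
  -- Whoever simulates `v` announces its answer: this is the extra bit.
  · exact (hτ.alice hcard (A.answer T v) fun x y y' h =>
      congrArg (A.output v) (hA v hv x y y' h)).exists_protocol Prod.snd
  · exact (hτ.bob hcard (A.answer T v) fun x x' y h =>
      congrArg (A.output v) (hB v hv x x' y h)).exists_protocol Prod.snd

/-- Without communication, a node's answer depends on one of the two inputs only. -/
theorem DSDAlgorithm.answer_zero_eq (hp : 1 ≤ p) (v : LBVertex k p) :
    (∀ (A : DSDAlgorithm k p B) x y y', A.answer 0 v x y = A.answer 0 v x y') ∨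
    (∀ (A : DSDAlgorithm k p B) x x' y, A.answer 0 v x y = A.answer 0 v x' y) := by
  have h0 : 2 * 0 + 2 ≤ 2 ^ p := Nat.pow_le_pow_right two_pos hp
  exact (mem_aliceRegion_or_bobRegion h0 v).imp
    (fun hv A x y y' => congrArg (A.output v) (A.stateAfter_zero_of_aliceRegion hv x y y'))
    (fun hv A x x' y => congrArg (A.output v) (A.stateAfter_zero_of_bobRegion hv x x' y))

end Simulation

end LowerBoundGraph

/-! ### Disjointness without communication -/

/-- With one input all ones, the other can still force either answer, so no function of a single
input computes `disj`. -/
theorem disj_const_true_left {k : ℕ} (hk : 0 < k) (b : Bool) :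
    disj (fun _ : Fin k => true) (fun _ => !b) = b := by
  cases b
  · simpa [disj] using Fin.pos_iff_nonempty.1 hk
  · simp [disj]

theorem disj_const_true_right {k : ℕ} (hk : 0 < k) (b : Bool) :
    disj (fun _ : Fin k => !b) (fun _ => true) = b := by
  cases b
  · simpa [disj] using Fin.pos_iff_nonempty.1 hk
  · simp [disj]

/-- If the answers computing disjointness depend on one of the two inputs only, then constant
answers do equally well. -/
theorem ComputesDisjWithError.exists_const {k : ℕ} (hk : 0 < k) {Ω : Type*} [MeasurableSpace Ω]
    {μ : MeasureTheory.Measure Ω} {ε : ENNReal}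
    {F : Ω → (Fin k → Bool) → (Fin k → Bool) → Bool} (hF : ComputesDisjWithError μ ε F)
    (h : (∀ ω x y y', F ω x y = F ω x y') ∨ (∀ ω x x' y, F ω x y = F ω x' y)) :
    ∃ b : Ω → Bool, ComputesDisjWithError (k := k) μ ε fun ω _ _ => b ω := by
  refine ⟨fun ω => F ω (fun _ => true) (fun _ => true), fun x y => ?_⟩
  -- If `F` ignores `y`, its answer at `(1, 1)` is also its answer at `(1, !disj x y)`, where the
  -- correct value is again `disj x y`; the error events coincide.
  rcases h with h | h
  · have := hF (fun _ => true) (fun _ => !disj x y)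
    simp only [disj_const_true_left hk] at this
    simpa only [h _ (fun _ => true) (fun _ => !disj x y) fun _ => true] using this
  · have := hF (fun _ => !disj x y) (fun _ => true)
    simp only [disj_const_true_right hk] at this
    simpa only [h _ (fun _ => !disj x y) (fun _ => true) fun _ => true] using this

/-! ### The bound on the cost -/

theorem card_lbVertex (k p : ℕ) :
    Fintype.card (LBVertex k p) + 1 = k * 2 ^ p + 2 ^ (p + 1) := by
  have h : ∑ d ∈ Finset.range (p + 1), 2 ^ d + 1 = 2 ^ (p + 1) := by
    have := Nat.geomSum_eq le_rfl (p + 1)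
    have : 0 < 2 ^ (p + 1) := by positivity
    omega
  simp only [Fintype.card_sum, Fintype.card_sigma, Fintype.card_fin, Fintype.card_prod,
    Fin.sum_univ_eq_sum_range (2 ^ ·)]
  omega

/-- The constant of the simulation theorem. -/
noncomputable def simulationConstant (c₂ β : ℝ) : ℝ := 24 * c₂ ^ 2 + 6 * (|β| + 1)

section Bounds

variable {c₂ β n : ℝ} {k p B T : ℕ}

theorem simulationConstant_pos (c₂ β : ℝ) : 0 < simulationConstant c₂ β := by
  unfold simulationConstant
  positivity

theorem three_le_card (hp : 1 ≤ p) (hn : n = (Fintype.card (LBVertex k p) : ℝ)) : 3 ≤ n := by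
  have h := card_lbVertex k p
  have h2 : 2 ^ 2 ≤ 2 ^ (p + 1) := Nat.pow_le_pow_right two_pos (by omega)
  rw [hn]
  exact_mod_cast (by omega : 3 ≤ Fintype.card (LBVertex k p))

theorem one_le_log_card (hp : 1 ≤ p) (hn : n = (Fintype.card (LBVertex k p) : ℝ)) :
    1 ≤ Real.log n := by
  have h3 := three_le_card hp hn
  rw [Real.le_log_iff_exp_le (by linarith)]
  linarith [Real.exp_one_lt_d9]

theorem le_two_mul_log_card (hn : n = (Fintype.card (LBVertex k p) : ℝ)) :
    (p : ℝ) ≤ 2 * Real.log n := by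
  have h := card_lbVertex k p
  have h1 : 0 < 2 ^ p := by positivity
  have h2 : (2 : ℝ) ^ p ≤ n := by
    rw [hn]
    exact_mod_cast (by rw [pow_succ] at h; omega : 2 ^ p ≤ Fintype.card (LBVertex k p))
  have h3 := Real.log_le_log (by positivity) h2
  rw [Real.log_pow] at h3
  have : (p : ℝ) * (1 / 2) ≤ p * Real.log 2 :=
    mul_le_mul_of_nonneg_left (by linarith [Real.log_two_gt_d9]) p.cast_nonneg
  linarith

/-- Here `p ≤ 2 log n` and `B + 1 ≤ (|β| + 1) log n`; as `T ≥ 1`, the final bit is absorbed by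
raising the factor `2` to `3`, whence `6 * (|β| + 1)`. -/
theorem simulation_cost_le (hp : 1 ≤ p) (hT : 1 ≤ T)
    (hn : n = (Fintype.card (LBVertex k p) : ℝ)) (hB : (B : ℝ) ≤ β * Real.log n) :
    ((T * (2 * (p * (B + 1))) + 1 : ℕ) : ℝ) ≤ simulationConstant c₂ β * (T * Real.log n ^ 2) := by
  have hlog := one_le_log_card hp hn
  have hplog := le_two_mul_log_card hn
  have hB1 : (B : ℝ) + 1 ≤ (|β| + 1) * Real.log n := by
    nlinarith [le_abs_self β]
  have hpB : (p : ℝ) * (B + 1) ≤ 2 * Real.log n * ((|β| + 1) * Real.log n) :=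
    mul_le_mul hplog hB1 (by positivity) (by linarith)
  have h1 : T * (2 * (p * (B + 1))) + 1 ≤ T * (3 * (p * (B + 1))) := by
    have : 1 * (1 * 1) ≤ T * (p * (B + 1)) :=
      Nat.mul_le_mul hT (Nat.mul_le_mul hp (Nat.le_add_left 1 B))
    nlinarith
  have hT0 : (0 : ℝ) ≤ T := T.cast_nonneg
  calc ((T * (2 * (p * (B + 1))) + 1 : ℕ) : ℝ) ≤ ((T * (3 * (p * (B + 1))) : ℕ) : ℝ) :=
        Nat.cast_le.2 h1
    _ = T * (3 * (p * (B + 1))) := by push_cast; ring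
    _ ≤ T * (3 * (2 * Real.log n * ((|β| + 1) * Real.log n))) := by gcongr
    _ = 6 * (|β| + 1) * (T * Real.log n ^ 2) := by ring
    _ ≤ simulationConstant c₂ β * (T * Real.log n ^ 2) := by
        unfold simulationConstant
        gcongr
        nlinarith [sq_nonneg c₂]

/-- From `n ≤ 3 * k * 2 ^ p`, `k ≤ c₂ * √n` and `2 ^ p ≤ 4 * T` follows `√n ≤ 12 * c₂ * T`. Then `k
+ 1 ≤ 2 * k` gives the summand `24 * c₂ ^ 2`. -/
theorem trivial_cost_le (hk : 1 ≤ k) (hp : 1 ≤ p) (hT : 2 ^ p < 2 * T + 2)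
    (hn : n = (Fintype.card (LBVertex k p) : ℝ)) (hk₂ : (k : ℝ) ≤ c₂ * √n) :
    ((k + 1 : ℕ) : ℝ) ≤ simulationConstant c₂ β * (T * Real.log n ^ 2) := by
  have hlog := one_le_log_card hp hn
  have hp2 : 2 ^ 1 ≤ 2 ^ p := Nat.pow_le_pow_right two_pos hp
  have h4T : (2 : ℝ) ^ p ≤ 4 * T := by exact_mod_cast (by omega : 2 ^ p ≤ 4 * T)
  have hk1 : (1 : ℝ) ≤ k := by exact_mod_cast hk
  have hn0 : 0 < n := by linarith [three_le_card hp hn]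
  have hs : 0 < √n := Real.sqrt_pos.2 hn0
  have hc : 0 < c₂ := pos_of_mul_pos_left (by linarith) hs.le
  have hnk : n ≤ 3 * k * 2 ^ p := by
    have h : (n : ℝ) + 1 = k * 2 ^ p + 2 ^ (p + 1) := by
      rw [hn]; exact_mod_cast card_lbVertex k p
    rw [pow_succ] at h
    nlinarith [pow_pos (two_pos : (0 : ℝ) < 2) p]
  have hsqrt : √n ≤ 12 * c₂ * T := by
    refine le_of_mul_le_mul_right ?_ hs
    calc √n * √n = n := Real.mul_self_sqrt hn0.le
      _ ≤ 3 * k * 2 ^ p := hnk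
      _ ≤ 3 * (c₂ * √n) * (4 * T) := by gcongr
      _ = 12 * c₂ * T * √n := by ring
  have hT0 : (0 : ℝ) ≤ T := T.cast_nonneg
  calc ((k + 1 : ℕ) : ℝ) ≤ 2 * k := by push_cast; linarith
    _ ≤ 2 * (c₂ * (12 * c₂ * T)) := by
        gcongr
        exact hk₂.trans (by gcongr)
    _ = 24 * c₂ ^ 2 * (T * 1 ^ 2) := by ring
    _ ≤ simulationConstant c₂ β * (T * Real.log n ^ 2) := by
        unfold simulationConstant
        gcongr
        linarith [abs_nonneg β]

end Bounds

theorem mainTheorem4 (c₁ c₂ β : ℝ) (hc₁ : 0 < c₁) :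
    ∃ C : ℝ, 0 < C ∧ ∀ (k p B T : ℕ) (n : ℝ), 1 ≤ p →
      n = (Fintype.card (LBVertex k p) : ℝ) →
      c₁ * √n ≤ (k : ℝ) → (k : ℝ) ≤ c₂ * √n → (B : ℝ) ≤ β * Real.log n →
      -- deterministic algorithms and protocols
      (∀ (A : DSDAlgorithm k p B) (v : LBVertex k p),
        (∀ x y, A.answer T v x y = disj x y) →
        ∃ P : Protocol (Fin k → Bool) (Fin k → Bool),
          (∀ x y, P.eval x y = disj x y) ∧ (P.cost : ℝ) ≤ C * (T * Real.log n ^ 2)) ∧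
      -- randomized algorithms and public-coin protocols
      (∀ (Ω : Type*) [MeasurableSpace Ω] (μ : MeasureTheory.Measure Ω)
        [MeasureTheory.IsProbabilityMeasure μ] (ε : ENNReal)
        (A : Ω → DSDAlgorithm k p B) (v : LBVertex k p),
        ComputesDisjWithError μ ε (fun ω => (A ω).answer T v) →
        ∃ P : Ω → Protocol (Fin k → Bool) (Fin k → Bool),
          ComputesDisjWithError μ ε (fun ω => (P ω).eval) ∧
          ∀ ω, ((P ω).cost : ℝ) ≤ C * (T * Real.log n ^ 2)) := by

  refine ⟨simulationConstant c₂ β, simulationConstant_pos c₂ β,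
    fun k p B T n hp hn hk₁ hk₂ hB => ?_⟩
  -- The lower bound on `k` serves to exclude `k = 0`, where `disj` is constant.
  have hk : 0 < k := by
    have hn0 : 0 < n := by linarith [three_le_card hp hn]
    have : 0 < c₁ * √n := mul_pos hc₁ (Real.sqrt_pos.2 hn0)
    exact_mod_cast this.trans_le hk₁
  rcases lt_or_ge (2 ^ p) (2 * T + 2) with hT | hT
  · obtain ⟨P, hP, hc⟩ := exists_protocol_of_function (disj (k := k))
    have hcost : (P.cost : ℝ) ≤ simulationConstant c₂ β * (T * Real.log n ^ 2) :=
      (Nat.cast_le.2 hc).trans (trivial_cost_le hk hp hT hn hk₂)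
    exact ⟨fun _ _ _ => ⟨P, hP, hcost⟩, fun Ω _ μ _ ε _ _ _ =>
      ⟨fun _ => P, fun x y => by simp [hP], fun _ => hcost⟩⟩
  rcases Nat.eq_zero_or_pos T with rfl | hT1
  -- For `T = 0` the budget is zero. A correct deterministic algorithm is impossible; a randomized
  -- one may exist for large `ε`, and is replaced by leaves.
  · refine ⟨fun A v hA => ?_, fun Ω _ μ _ ε A v hA => ?_⟩
    · exfalso
      rcases DSDAlgorithm.answer_zero_eq (B := B) hp v with h | h
      · have := h A (fun _ => true) (fun _ => !true) (fun _ => !false)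
        rw [hA, hA, disj_const_true_left hk, disj_const_true_left hk] at this
        exact Bool.noConfusion this
      · have := h A (fun _ => !true) (fun _ => !false) (fun _ => true)
        rw [hA, hA, disj_const_true_right hk, disj_const_true_right hk] at this
        exact Bool.noConfusion this
    · obtain ⟨b, hb⟩ := ComputesDisjWithError.exists_const hk hA
        ((DSDAlgorithm.answer_zero_eq hp v).imp (fun h ω => h (A ω)) fun h ω => h (A ω))
      exact ⟨fun ω => .leaf (b ω), hb, fun ω => by simp [Protocol.cost]⟩
  · have hbound := simulation_cost_le (c₂ := c₂) hp hT1 hn hB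
    refine ⟨fun A v hA => ?_, fun Ω _ μ _ ε A v hA => ?_⟩
    · obtain ⟨P, hP, hc⟩ := A.exists_protocol T hT v
      exact ⟨P, fun x y => (hP x y).trans (hA x y), (Nat.cast_le.2 hc).trans hbound⟩
    -- The simulation is exact for each `ω`, so the error event is the same set.
    · choose P hP hc using fun ω => (A ω).exists_protocol T hT v
      refine ⟨P, fun x y => ?_, fun ω => (Nat.cast_le.2 (hc ω)).trans hbound⟩
      simpa only [hP] using hA x y
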